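/- Let $D$ be an integral domain with quotient field $K$. An overring of $D$ is a ring $T$ with $D\subseteq T\subseteq K$. The set $\mathrm{Over}(D)$ of all overrings of $D$ is endowed with the Zariski topology, which has as a basis of open sets the sets $B(x_1,\ldots,x_n)=\{T\in\mathrm{Over}(D)\mid x_1,\ldots,x_n\in T\}$ with $x_1,\ldots,x_n\in K$; this is a spectral space. Let $\mathrm{Over}_{qr}(D)\subseteq\mathrm{Over}(D)$ be the set of quotient rings of $D$, i.e., of the overrings of the form $S^{-1}D$ for some multiplicatively closed subset $S\subseteq D\setminus\{0\}$ (with $1\in S$). A subset of a spectral space is called proconstructible if it is closed in the constructible topology, that is, in the coarsest topology in which all open compact subsets of the original topology are both open and closed. Let $X^1(D)$ be the set of height-one prime ideals of $D$, and suppose that $D$ is a Krull domain, that is, $D_P$ is a discrete valuation ring for every $P\in X^1(D)$, $D=\bigcap_{P\in X^1(D)}D_P$ (the intersection being $K$ if $X^1(D)=\emptyset$), and every nonzero element of $D$ is contained in only finitely many $P\in X^1(D)$. The (divisor) class group of $D$ is the quotient of the free abelian group on $X^1(D)$ by the subgroup of the principal divisors $\sum_{P\in X^1(D)}v_P(x)P$,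 $x\in K\setminus\{0\}$, where $v_P$ is the normalized valuation of $D_P$. Then the following are equivalent: (i) $\mathrm{Over}_{qr}(D)$ is proconstructible in $\mathrm{Over}(D)$; (ii) every $P\in X^1(D)$ is the radical of a principal ideal of $D$; (iii) the class group of $D$ is a torsion group. -/

import Mathlib

open scoped nonZeroDivisors Topology

/-- A subset of a (spectral) topological space is *proconstructible* if it is closed in the
constructible topology, i.e. the coarsest topology in which every open compact subset of the
original topology is both open and closed. -/
def IsProconstructible {X : Type*} [TopologicalSpace X] (Y : Set X) : Prop :=
  IsClosed[constructibleTopology X] Y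

/-- The overrings of a domain `D` with quotient field `K`: the rings comprised between (the image
of) `D` and `K`. -/
abbrev Overring (D K : Type*) [CommRing D] [Field K] [Algebra D K] : Type _ :=
  Subalgebra D K

/-- The Zariski topology on the set of overrings: a basis of open sets is given by the sets
`B(x₁, …, xₙ)` of all overrings containing `x₁, …, xₙ`, where `x₁, …, xₙ` range in `K`. -/
instance overringZariskiTopology (D K : Type*) [CommRing D] [Field K] [Algebra D K] :
    TopologicalSpace (Overring D K) :=
  .generateFrom {U | ∃ F : Finset K, U = {T : Overring D K | ∀ x ∈ F, x ∈ T}}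

/-- The sets `B(x₁, …, xₙ)` are indeed a basis of the Zariski topology. -/
theorem isTopologicalBasis_overringZariskiTopology (D K : Type*) [CommRing D] [Field K]
    [Algebra D K] : TopologicalSpace.IsTopologicalBasis
      {U | ∃ F : Finset K, U = {T : Overring D K | ∀ x ∈ F, x ∈ T}} where
  exists_subset_inter := by
    classical
    rintro _ ⟨F, rfl⟩ _ ⟨G, rfl⟩ T ⟨hF, hG⟩
    refine ⟨_, ⟨F ∪ G, rfl⟩, fun x hx => ?_, fun S hS => ⟨fun x hx => ?_, fun x hx => ?_⟩⟩
    · exact (Finset.mem_union.1 hx).elim (hF x) (hG x)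
    · exact hS x (Finset.mem_union_left _ hx)
    · exact hS x (Finset.mem_union_right _ hx)
  sUnion_eq := Set.eq_univ_of_forall fun T => ⟨_, ⟨∅, rfl⟩, by simp⟩
  eq_generateFrom := rfl

section

variable (D K : Type*) [CommRing D] [IsDomain D] [Field K] [Algebra D K] [IsFractionRing D K]

/-- The set of all quotient rings of `D`, i.e. of all overrings of the form
`S⁻¹D = {a / s | a ∈ D, s ∈ S}` where `S` is a multiplicatively closed subset of `D` (with
`0 ∉ S`, so that `S⁻¹D` is contained in `K`). -/
def quotientOverrings : Set (Overring D K) :=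
  {T | ∃ (S : Submonoid D) (hS : S ≤ D⁰), T = Localization.subalgebra.ofField K S hS}

/-- The height-one prime ideals of `D`. -/
def HeightOnePrime (D : Type*) [CommRing D] : Type _ :=
  {P : PrimeSpectrum D // P.asIdeal.height = 1}

variable {D}

/-- The prime ideal underlying an element of `HeightOnePrime D`. -/
def HeightOnePrime.asIdeal {D : Type*} [CommRing D] (P : HeightOnePrime D) : Ideal D :=
  P.1.asIdeal

instance HeightOnePrime.isPrime {D : Type*} [CommRing D] (P : HeightOnePrime D) :
    P.asIdeal.IsPrime :=
  P.1.isPrime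

/-- The localization `D_P = {a / s | a ∈ D, s ∉ P}` of `D` at a height-one prime ideal `P`, as
an overring of `D`. -/
noncomputable def HeightOnePrime.localization (P : HeightOnePrime D) : Overring D K :=
  Localization.subalgebra.ofField K P.asIdeal.primeCompl P.asIdeal.primeCompl_le_nonZeroDivisors

instance HeightOnePrime.isLocalization_localization (P : HeightOnePrime D) :
    IsLocalization.AtPrime (P.localization K) P.asIdeal :=
  inferInstanceAs <| IsLocalization P.asIdeal.primeCompl <|
    Localization.subalgebra.ofField K P.asIdeal.primeCompl P.asIdeal.primeCompl_le_nonZeroDivisors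

variable (D)

/-- A domain `D` with quotient field `K` is a *Krull domain* if `D_P` is a discrete valuation ring
for every height-one prime `P`, if `D` is the intersection of these rings `D_P` (in `K`), and if
every nonzero element of `D` belongs to only finitely many height-one primes. A field is a Krull
domain: the intersection of the empty family is `K`. -/
class IsKrullDomain : Prop where
  isDiscreteValuationRing (P : HeightOnePrime D) : IsDiscreteValuationRing (P.localization K)
  iInf_localization : ⨅ P : HeightOnePrime D, P.localization K = (⊥ : Overring D K)
  finite_setOf_mem (a : D) (ha : a ≠ 0) : {P : HeightOnePrime D | a ∈ P.asIdeal}.Finite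

attribute [instance] IsKrullDomain.isDiscreteValuationRing

variable [IsKrullDomain D K]

variable {D}

/-- The normalized discrete valuation `ord_P : Kˣ → ℤ` of the discrete valuation ring `D_P`.
(The sign changes from the multiplicative to the additive convention: Mathlib's valuation takes
the value `exp (-1)` at a uniformizer.) -/
noncomputable def HeightOnePrime.ord (P : HeightOnePrime D) (x : Kˣ) : ℤ :=
  -WithZero.log ((IsDiscreteValuationRing.maximalIdeal (P.localization K)).valuation K x)

variable {K}

theorem HeightOnePrime.ord_one (P : HeightOnePrime D) : P.ord K 1 = 0 := by
  simp [HeightOnePrime.ord]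

theorem HeightOnePrime.ord_mul (P : HeightOnePrime D) (x y : Kˣ) :
    P.ord K (x * y) = P.ord K x + P.ord K y := by
  simp only [HeightOnePrime.ord, Units.val_mul, map_mul]
  rw [WithZero.log_mul (by simp) (by simp), neg_add]

/-- The valuation `ord_P` vanishes at the elements of `D` outside `P`. -/
theorem HeightOnePrime.ord_eq_zero (P : HeightOnePrime D) (x : Kˣ) (a : D)
    (hx : (x : K) = algebraMap D K a) (ha : a ∉ P.asIdeal) : P.ord K x = 0 := by
  have hu : IsUnit (algebraMap D (P.localization K) a) :=
    IsLocalization.map_units (P.localization K) (⟨a, ha⟩ : P.asIdeal.primeCompl)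
  have h : algebraMap D (P.localization K) a ∉
      (IsDiscreteValuationRing.maximalIdeal (P.localization K)).asIdeal := fun hm =>
    (IsLocalRing.mem_maximalIdeal _).1 hm hu
  rw [HeightOnePrime.ord, hx, IsScalarTower.algebraMap_apply D (P.localization K) K,
    IsDedekindDomain.HeightOneSpectrum.valuation_eq_one_iff_notMem (K := K) _ |>.2 h, WithZero.log_one, neg_zero]

variable (D K)

theorem HeightOnePrime.finite_support_ord (x : Kˣ) :
    (Function.support fun P : HeightOnePrime D => P.ord K x).Finite := by
  obtain ⟨a, b, hb, hab⟩ := IsFractionRing.div_surjective D (x : K)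
  have hb0 : b ≠ 0 := nonZeroDivisors.ne_zero hb
  have hbK : algebraMap D K b ≠ 0 := by simpa using hb0
  have haK : algebraMap D K a ≠ 0 := fun h => x.ne_zero (by rw [← hab, h, zero_div])
  have ha0 : a ≠ 0 := by rintro rfl; simp at haK
  refine ((IsKrullDomain.finite_setOf_mem K a ha0).union
    (IsKrullDomain.finite_setOf_mem K b hb0)).subset fun P hP => ?_
  by_contra hn
  simp only [Set.mem_union, Set.mem_ofPred_eq, not_or] at hn
  have hxb : x * Units.mk0 _ hbK = Units.mk0 _ haK := by
    ext
    simp [← hab, hbK]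
  have h := P.ord_mul x (Units.mk0 _ hbK)
  rw [hxb, P.ord_eq_zero (Units.mk0 _ haK) a rfl hn.1, P.ord_eq_zero (Units.mk0 _ hbK) b rfl hn.2, add_zero] at h
  exact hP h.symm

/-- The principal divisor map `x ↦ div x = ∑_P ord_P(x) P` from `Kˣ` to the free abelian group on
the height-one primes of the Krull domain `D`. -/
noncomputable def principalDivisor : Additive Kˣ →+ (HeightOnePrime D →₀ ℤ) where
  toFun x := Finsupp.ofSupportFinite (fun P => P.ord K x.toMul)
    (HeightOnePrime.finite_support_ord D K x.toMul)
  map_zero' := Finsupp.ext fun P => P.ord_one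
  map_add' x y := Finsupp.ext fun P => P.ord_mul x.toMul y.toMul

/-- The (divisor) class group of a Krull domain: divisors, i.e. formal integral linear combinations
of height-one primes, modulo principal divisors. -/
abbrev DivisorClassGroup : Type _ :=
  (HeightOnePrime D →₀ ℤ) ⧸ (principalDivisor D K).range

end

/-! ### The constructible topology on the space of overrings -/

section Topology

variable {D K : Type*} [CommRing D] [Field K] [Algebra D K]

/-! Over a Krull domain, membership in `D` and in the rings `D_P` is read off from the valuations
`v_P`.

(iii) ⇒ (i): some multiple `n` of the pole divisor of `x` is the divisor of some `b ∈ D`. If `x = c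
/ s` with `s ∈ S`, the divisor of `s` dominates the poles of `x`, so `b` divides `s ^ n` and `1 / b
∈ S⁻¹D`. Since `x * b ∈ D`, the quotient rings are exactly the overrings `T` with `x ∈ T → 1 / b ∈
T` for every `x`, an intersection of constructibly closed sets
(`exists_denominator_of_isAddTorsion`).

(i) ⇒ (ii): the intersection `T_P` of the `D_Q`, `Q ≠ P`, is always a constructible limit of
quotient rings, so under (i) it is some `S⁻¹D` (`HeightOnePrime.localizationAway_mem`). Some element
has its only pole at `P`, so `S` meets `P`; any `s` in both lies in no other height-one prime, and
`P` is the radical of `(s)`.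

(ii) ⇒ (iii): if `P` is the radical of `(a)`, then `div a` is a positive multiple of `P`, and the
`P` generate the class group. -/

theorem isOpen_setOf_forall_mem_overring (F : Finset K) :
    IsOpen {T : Overring D K | ∀ x ∈ F, x ∈ T} :=
  (isTopologicalBasis_overringZariskiTopology D K).isOpen ⟨F, rfl⟩

theorem isOpen_setOf_mem_overring (x : K) : IsOpen {T : Overring D K | x ∈ T} := by
  simpa using isOpen_setOf_forall_mem_overring (D := D) {x}

/-- Every Zariski-open set containing `D[x]` contains all the overrings containing `x`. -/
theorem isCompact_setOf_mem_overring (x : K) : IsCompact {T : Overring D K | x ∈ T} := by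
  refine isCompact_of_finite_subcover fun U hUo hU => ?_
  obtain ⟨i, hi⟩ := Set.mem_iUnion.1 (@hU (Algebra.adjoin D {x})
    (Algebra.self_mem_adjoin_singleton D x))
  obtain ⟨_, ⟨F, rfl⟩, hF, hFU⟩ :=
    (isTopologicalBasis_overringZariskiTopology D K).exists_subset_of_mem_open hi (hUo i)
  refine ⟨{i}, fun T hT => ?_⟩
  simp only [Finset.mem_singleton, Set.iUnion_iUnion_eq_left]
  exact hFU fun y hy => Algebra.adjoin_le (Set.singleton_subset_iff.2 hT) (hF y hy)

theorem isOpen_constructibleTopology_setOf_mem_overring (x : K) :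
    IsOpen[constructibleTopology (Overring D K)] {T : Overring D K | x ∈ T} :=
  (isCompact_setOf_mem_overring x).isOpen_constructibleTopology_of_isOpen
    (isOpen_setOf_mem_overring x)

theorem isOpen_constructibleTopology_setOf_notMem_overring (x : K) :
    IsOpen[constructibleTopology (Overring D K)] {T : Overring D K | x ∉ T} := by
  refine IsCompact.isOpen_constructibleTopology_of_isClosed ?_ ?_
  · simpa [Set.compl_ofPred] using isCompact_setOf_mem_overring (D := D) x
  · exact (isOpen_setOf_mem_overring x).isClosed_compl

theorem isProconstructible_setOf_mem_imp_mem (x y : K) :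
    IsProconstructible {T : Overring D K | x ∈ T → y ∈ T} := by
  let := constructibleTopology (Overring D K)
  refine ⟨?_⟩
  have : {T : Overring D K | x ∈ T → y ∈ T}ᶜ = {T | x ∈ T} ∩ {T | y ∉ T} := by
    ext T
    simp
  rw [this]
  exact (isOpen_constructibleTopology_setOf_mem_overring x).inter
    (isOpen_constructibleTopology_setOf_notMem_overring y)

/-- The sets defined by finitely many conditions `x ∈ T` or `x ∉ T` form neighbourhood bases in
the constructible topology. -/
theorem exists_finset_of_isOpen_constructibleTopology {U : Set (Overring D K)}
    (hU : IsOpen[constructibleTopology (Overring D K)] U) {T : Overring D K} (hT : T ∈ U) :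
    ∃ F G : Finset K, (∀ x ∈ F, x ∈ T) ∧ (∀ x ∈ G, x ∉ T) ∧
      ∀ T' : Overring D K, (∀ x ∈ F, x ∈ T') → (∀ x ∈ G, x ∉ T') → T' ∈ U := by
  classical
  induction hU with
  | basic s hs =>
    rcases hs with ⟨ho, -⟩ | ⟨hc, hcomp⟩
    · obtain ⟨_, ⟨F, rfl⟩, hF, hFU⟩ :=
        (isTopologicalBasis_overringZariskiTopology D K).exists_subset_of_mem_open hT ho
      exact ⟨F, ∅, hF, by simp, fun T' h _ => hFU h⟩
    -- The open complement misses `T`, so each ring in it contains some `g ∉ T`; by compactness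
    -- finitely many such `g` suffice.
    · obtain ⟨G, hG⟩ := hcomp.elim_finite_subcover
        (fun g : {g : K // g ∉ T} => {T' : Overring D K | (g : K) ∈ T'})
        (fun g => isOpen_setOf_mem_overring _) (fun T' hT' => by
          obtain ⟨_, ⟨F, rfl⟩, hF, hFU⟩ := (isTopologicalBasis_overringZariskiTopology D
            K).exists_subset_of_mem_open hT' hc.isOpen_compl
          have hn : ¬ ∀ x ∈ F, x ∈ T := fun h => hFU h hT
          push Not at hn
          obtain ⟨g, hgF, hgT⟩ := hn
          exact Set.mem_iUnion.2 ⟨⟨g, hgT⟩, hF g hgF⟩)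
      refine ⟨∅, G.image Subtype.val, by simp, by simp +contextual, fun T' _ hT' => ?_⟩
      by_contra hn
      obtain ⟨g, hg, hgT'⟩ := Set.mem_iUnion₂.1 (hG hn)
      exact hT' g (Finset.mem_image_of_mem _ hg) hgT'
  | univ => exact ⟨∅, ∅, by simp, by simp, fun _ _ _ => Set.mem_univ _⟩
  | inter s t _ _ ihs iht =>
    obtain ⟨F₁, G₁, hF₁, hG₁, h₁⟩ := ihs hT.1
    obtain ⟨F₂, G₂, hF₂, hG₂, h₂⟩ := iht hT.2
    refine ⟨F₁ ∪ F₂, G₁ ∪ G₂, ?_, ?_, fun T' hF hG => ⟨h₁ T' ?_ ?_, h₂ T' ?_ ?_⟩⟩ <;> grind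
  | sUnion S _ ih =>
    obtain ⟨s, hs, hTs⟩ := hT
    obtain ⟨F, G, hF, hG, h⟩ := ih s hs hTs
    exact ⟨F, G, hF, hG, fun T' h₁ h₂ => ⟨s, hs, h T' h₁ h₂⟩⟩

theorem IsProconstructible.mem_of_forall_finset {Y : Set (Overring D K)}
    (hY : IsProconstructible Y) {T : Overring D K}
    (hT : ∀ F G : Finset K, (∀ x ∈ F, x ∈ T) → (∀ x ∈ G, x ∉ T) →
      ∃ T' ∈ Y, (∀ x ∈ F, x ∈ T') ∧ ∀ x ∈ G, x ∉ T') : T ∈ Y := by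
  by_contra hn
  obtain ⟨F, G, hF, hG, h⟩ := exists_finset_of_isOpen_constructibleTopology
    (@IsClosed.isOpen_compl _ (constructibleTopology (Overring D K)) Y hY) hn
  obtain ⟨T', hT'Y, h₁, h₂⟩ := hT F G hF hG
  exact h T' h₁ h₂ hT'Y

end Topology

/-! ### Quotient rings among the overrings. -/

section QuotientRings

variable {D K : Type*} [CommRing D] [IsDomain D] [Field K] [Algebra D K] [IsFractionRing D K]

omit [IsDomain D] in
theorem mem_ofField_iff {S : Submonoid D} {hS : S ≤ D⁰} {x : K} :
    x ∈ Localization.subalgebra.ofField K S hS ↔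
      ∃ a s : D, s ∈ S ∧ x = algebraMap D K a * (algebraMap D K s)⁻¹ := by
  constructor
  · rintro ⟨a, s, hs, h⟩
    exact ⟨a, s, hs, h⟩
  · rintro ⟨a, s, hs, h⟩
    exact ⟨a, s, hs, h⟩

/-- An overring `T` is a quotient ring if every element of `T` has a denominator in `D` which is
a unit of `T`. -/
theorem mem_quotientOverrings_of_forall_exists {T : Overring D K}
    (h : ∀ x ∈ T, ∃ a b : D, b ≠ 0 ∧ x = algebraMap D K a * (algebraMap D K b)⁻¹ ∧
      (algebraMap D K b)⁻¹ ∈ T) : T ∈ quotientOverrings D K := by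
  let S : Submonoid D :=
    { carrier := {b | b ≠ 0 ∧ (algebraMap D K b)⁻¹ ∈ T}
      one_mem' := by simp
      mul_mem' := fun {b c} hb hc => ⟨mul_ne_zero hb.1 hc.1, by
        rw [map_mul, mul_inv]
        exact mul_mem hb.2 hc.2⟩ }
  refine ⟨S, fun b hb => mem_nonZeroDivisors_of_ne_zero hb.1, ?_⟩
  ext x
  rw [mem_ofField_iff]
  constructor
  · intro hx
    obtain ⟨a, b, hb, hab, hbT⟩ := h x hx
    exact ⟨a, b, ⟨hb, hbT⟩, hab⟩
  · rintro ⟨a, b, hb, rfl⟩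
    exact mul_mem (T.algebraMap_mem a) hb.2

end QuotientRings

/-! ### Valuations on a Krull domain -/

section Krull

variable {D K : Type*} [CommRing D] [IsDomain D] [Field K] [Algebra D K] [IsFractionRing D K]

theorem HeightOnePrime.mem_localization_iff (P : HeightOnePrime D) {x : K} :
    x ∈ P.localization K ↔
      ∃ a s : D, s ∉ P.asIdeal ∧ x = algebraMap D K a * (algebraMap D K s)⁻¹ :=
  mem_ofField_iff

theorem HeightOnePrime.ne_bot (P : HeightOnePrime D) : P.asIdeal ≠ ⊥ :=
  Ideal.ne_bot_of_height_eq_one P.2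

omit [IsDomain D] in
theorem HeightOnePrime.eq_of_le {P Q : HeightOnePrime D} (h : P.asIdeal ≤ Q.asIdeal) : P = Q := by
  have hP : P.asIdeal.height = 1 := P.2
  have hQ : Q.asIdeal.height = 1 := Q.2
  have : P.asIdeal.FiniteHeight := Ideal.finiteHeight_iff _ |>.2 (.inr (by simp [hP]))
  exact Subtype.ext <| PrimeSpectrum.ext <|
    Ideal.eq_of_le_of_height_le P.asIdeal h (hQ.trans hP.symm).le

variable (K) in
/-- The intersection of the localizations of `D` at the height-one primes different from `P`. -/
noncomputable def HeightOnePrime.localizationAway (P : HeightOnePrime D) : Overring D K :=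
  ⨅ Q : {Q : HeightOnePrime D // Q ≠ P}, Q.1.localization K

theorem HeightOnePrime.mem_localizationAway_iff (P : HeightOnePrime D) {x : K} :
    x ∈ P.localizationAway K ↔ ∀ Q : HeightOnePrime D, Q ≠ P → x ∈ Q.localization K := by
  simp [localizationAway, Algebra.mem_iInf]

variable [IsKrullDomain D K]

namespace HeightOnePrime

theorem ord_pow (P : HeightOnePrime D) (x : Kˣ) (n : ℕ) : P.ord K (x ^ n) = n * P.ord K x := by
  induction n with
  | zero => simp [P.ord_one]
  | succ n ih => rw [pow_succ, P.ord_mul, ih]; push_cast; ring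

theorem ord_inv (P : HeightOnePrime D) (x : Kˣ) : P.ord K x⁻¹ = -P.ord K x := by
  have := P.ord_mul x x⁻¹
  rw [mul_inv_cancel, P.ord_one] at this
  lia

theorem ord_nonneg_iff (P : HeightOnePrime D) (x : Kˣ) :
    0 ≤ P.ord K x ↔ (x : K) ∈ P.localization K := by
  have h : 0 ≤ P.ord K x ↔
      (IsDiscreteValuationRing.maximalIdeal (P.localization K)).valuation K (x : K) ≤ 1 := by
    rw [ord, neg_nonneg, WithZero.log_le_iff_le_exp (by simp), WithZero.exp_zero]
  rw [h]
  constructor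
  · intro hx
    obtain ⟨a, ha⟩ := IsDiscreteValuationRing.exists_lift_of_le_one hx
    rw [← ha]
    exact a.2
  · intro hx
    exact IsDedekindDomain.HeightOneSpectrum.valuation_le_one _ (⟨x, hx⟩ : P.localization K)

theorem ord_algebraMap_nonneg (P : HeightOnePrime D) {x : Kˣ} {a : D}
    (hx : (x : K) = algebraMap D K a) : 0 ≤ P.ord K x := by
  rw [ord_nonneg_iff, hx]
  exact Subalgebra.algebraMap_mem _ a

theorem ord_pos_iff (P : HeightOnePrime D) {x : Kˣ} {a : D} (hx : (x : K) = algebraMap D K a) :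
    0 < P.ord K x ↔ a ∈ P.asIdeal := by
  constructor
  · intro h
    by_contra ha
    exact h.ne' (P.ord_eq_zero x a hx ha)
  · intro ha
    by_contra h
    -- Otherwise `1 / a = b / s` with `s ∉ P`, whereas `s = a * b ∈ P`.
    have h' : 0 ≤ P.ord K x⁻¹ := by rw [ord_inv]; lia
    rw [ord_nonneg_iff, mem_localization_iff] at h'
    obtain ⟨b, s, hs, h'⟩ := h'
    have hs0 : algebraMap D K s ≠ 0 := by
      rw [Ne, FaithfulSMul.algebraMap_eq_zero_iff]
      rintro rfl
      exact hs (zero_mem _)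
    refine hs ?_
    have : s = a * b := by
      apply FaithfulSMul.algebraMap_injective D K
      rw [map_mul, ← hx]
      rw [Units.val_inv_eq_inv_val, eq_mul_inv_iff_mul_eq₀ hs0] at h'
      rw [← h', mul_inv_cancel_left₀ x.ne_zero]
    rw [this]
    exact P.asIdeal.mul_mem_right _ ha

end HeightOnePrime

/-- This is `D = ⋂ D_P` in terms of valuations; the divisibilities in `D` used below are checked
through it, one height-one prime at a time. -/
theorem IsKrullDomain.exists_algebraMap_eq (x : Kˣ) (h : ∀ P : HeightOnePrime D, 0 ≤ P.ord K x) :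
    ∃ a : D, (x : K) = algebraMap D K a := by
  have hx : (x : K) ∈ (⊥ : Overring D K) := by
    rw [← IsKrullDomain.iInf_localization, Algebra.mem_iInf]
    exact fun P => (P.ord_nonneg_iff x).1 (h P)
  obtain ⟨a, ha⟩ := Algebra.mem_bot.1 hx
  exact ⟨a, ha.symm⟩

/-! ### Torsion class group implies proconstructible. -/

variable (D K) in
theorem isAddTorsion_divisorClassGroup_iff :
    IsAddTorsion (DivisorClassGroup D K) ↔ ∀ δ : HeightOnePrime D →₀ ℤ, ∃ n : ℕ, 0 < n ∧
      ∃ x : Kˣ, ∀ P : HeightOnePrime D, P.ord K x = n * δ P := by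
  have key (δ : HeightOnePrime D →₀ ℤ) : IsOfFinAddOrder (δ : DivisorClassGroup D K) ↔
      ∃ n : ℕ, 0 < n ∧ ∃ x : Kˣ, ∀ P : HeightOnePrime D, P.ord K x = n * δ P := by
    rw [isOfFinAddOrder_iff_nsmul_eq_zero]
    refine exists_congr fun n => and_congr_right fun _ => ?_
    rw [← QuotientAddGroup.mk_nsmul, QuotientAddGroup.eq_zero_iff]
    constructor
    · rintro ⟨x, hx⟩
      refine ⟨x.toMul, fun P => ?_⟩
      have := DFunLike.congr_fun hx P
      rw [Finsupp.smul_apply, nsmul_eq_mul] at this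
      exact this
    · rintro ⟨x, hx⟩
      refine ⟨.ofMul x, Finsupp.ext fun P => ?_⟩
      rw [Finsupp.smul_apply, nsmul_eq_mul]
      exact hx P
  constructor
  · exact fun h δ => (key δ).1 (h _)
  · intro h c
    obtain ⟨δ, rfl⟩ := QuotientAddGroup.mk_surjective c
    exact (key δ).2 (h δ)

/-- If the class group is torsion, every `x ∈ K` has a denominator which is a unit in all the
quotient rings containing `x`. -/
theorem exists_denominator_of_isAddTorsion (h : IsAddTorsion (DivisorClassGroup D K)) (x : K) :
    ∃ a b : D, b ≠ 0 ∧ x = algebraMap D K a * (algebraMap D K b)⁻¹ ∧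
      ∀ T ∈ quotientOverrings D K, x ∈ T → (algebraMap D K b)⁻¹ ∈ T := by
  rcases eq_or_ne x 0 with rfl | hx
  · exact ⟨0, 1, one_ne_zero, by simp, fun T _ _ => by simp⟩
  lift x to Kˣ using hx.isUnit
  -- Torsion is applied to the pole divisor of `x`; since `n ≥ 1`, the resulting `y` clears the
  -- poles of `x`.
  obtain ⟨n, hn, y, hy⟩ := (isAddTorsion_divisorClassGroup_iff D K).1 h
    ((principalDivisor D K (.ofMul x)).mapRange (fun m => max 0 (-m)) (by simp))
  replace hy (P : HeightOnePrime D) : P.ord K y = n * max 0 (-P.ord K x) := hy P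
  obtain ⟨b, hb⟩ := IsKrullDomain.exists_algebraMap_eq y fun P : HeightOnePrime D => by
    rw [hy]; positivity
  have hn1 : (1 : ℤ) ≤ n := by exact_mod_cast hn
  obtain ⟨a, ha⟩ := IsKrullDomain.exists_algebraMap_eq (x * y) fun P : HeightOnePrime D => by
    rw [P.ord_mul, hy]
    nlinarith [le_max_left 0 (-P.ord K x), le_max_right 0 (-P.ord K x)]
  refine ⟨a, b, ?_, ?_, ?_⟩
  · rintro rfl
    exact y.ne_zero (by rw [hb, map_zero])
  · rw [← ha, ← hb, Units.val_mul, mul_inv_cancel_right₀ y.ne_zero]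
  · rintro _ ⟨S, hS, rfl⟩ hxS
    obtain ⟨c, s, hs, hcs⟩ := mem_ofField_iff.1 hxS
    have hs0 : algebraMap D K s ≠ 0 := by
      simpa using nonZeroDivisors.ne_zero (hS hs)
    lift algebraMap D K s to Kˣ using hs0.isUnit with t ht
    have hxt : ((x * t : Kˣ) : K) = algebraMap D K c := by
      rw [Units.val_mul, hcs, inv_mul_cancel_right₀ t.ne_zero]
    -- As `x * s ∈ D`, the order of `s` is at least the pole order of `x` everywhere, so `s ^ n / b
    -- = d ∈ D` and `1 / b = d / s ^ n`.
    obtain ⟨d, hd⟩ := IsKrullDomain.exists_algebraMap_eq (t ^ n * y⁻¹)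
      fun P : HeightOnePrime D => by
        have h₁ := P.ord_algebraMap_nonneg hxt
        have h₂ := P.ord_algebraMap_nonneg ht
        rw [P.ord_mul] at h₁
        rw [P.ord_mul, P.ord_pow, P.ord_inv, hy, ← sub_eq_add_neg, ← mul_sub]
        exact mul_nonneg (by positivity) (sub_nonneg.2 (max_le h₂ (by lia)))
    refine mem_ofField_iff.2 ⟨d, s ^ n, pow_mem hs n, ?_⟩
    rw [← hd, map_pow, ← ht, ← hb]
    have := t.ne_zero
    push_cast
    field_simp

theorem isProconstructible_quotientOverrings_of_isAddTorsion
    (h : IsAddTorsion (DivisorClassGroup D K)) : IsProconstructible (quotientOverrings D K) := by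
  choose a b hb hab hT using exists_denominator_of_isAddTorsion h
  have : quotientOverrings D K =
      ⋂ x : K, {T : Overring D K | x ∈ T → (algebraMap D K (b x))⁻¹ ∈ T} := by
    ext T
    simp only [Set.mem_iInter, Set.mem_ofPred_eq]
    exact ⟨fun hTq x => hT x T hTq, fun hTx => mem_quotientOverrings_of_forall_exists
      fun x hx => ⟨a x, b x, hb x, hab x, hTx x hx⟩⟩
  rw [this]
  exact @isClosed_iInter _ _ (constructibleTopology (Overring D K)) _
    fun x => isProconstructible_setOf_mem_imp_mem _ _

/-! ### Radicals of principal ideals and torsion. -/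

variable (K) in
include K in
theorem HeightOnePrime.eq_radical_span_of_ord_eq_zero (P : HeightOnePrime D) {a : D} (ha : a ≠ 0)
    (haP : a ∈ P.asIdeal) (h : ∀ Q : HeightOnePrime D, Q ≠ P → a ∉ Q.asIdeal) :
    P.asIdeal = (Ideal.span {a}).radical := by
  apply le_antisymm
  · intro b hb
    rcases eq_or_ne b 0 with rfl | hb0
    · exact zero_mem _
    have haK : algebraMap D K a ≠ 0 := by simpa using ha
    have hbK : algebraMap D K b ≠ 0 := by simpa using hb0
    let x := Units.mk0 _ haK
    let y := Units.mk0 _ hbK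
    -- The exponent `v_P(a)` is enough at `P` because `v_P(b) ≥ 1`; at every other prime `a` has
    -- order zero.
    obtain ⟨d, hd⟩ := IsKrullDomain.exists_algebraMap_eq (y ^ (P.ord K x).toNat * x⁻¹)
      fun Q : HeightOnePrime D => by
        have hy : 0 ≤ Q.ord K y := Q.ord_algebraMap_nonneg rfl
        have hx : 0 ≤ Q.ord K x := Q.ord_algebraMap_nonneg rfl
        rw [Q.ord_mul, Q.ord_pow, Q.ord_inv]
        rcases eq_or_ne Q P with rfl | hQ
        · have : 0 < Q.ord K y := (Q.ord_pos_iff rfl).2 hb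
          rw [Int.toNat_of_nonneg hx]
          nlinarith
        · rw [Q.ord_eq_zero x a rfl (h Q hQ)]
          simpa using mul_nonneg (by positivity) hy
    refine ⟨(P.ord K x).toNat, Ideal.mem_span_singleton'.2 ⟨d, ?_⟩⟩
    apply FaithfulSMul.algebraMap_injective D K
    rw [map_mul, ← hd, map_pow]
    simp [x, y, haK]
  · rw [P.isPrime.radical_le_iff]
    simpa using haP

theorem isAddTorsion_of_forall_exists_eq_radical
    (h : ∀ P : HeightOnePrime D, ∃ a : D, P.asIdeal = (Ideal.span {a}).radical) :
    IsAddTorsion (DivisorClassGroup D K) := by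
  rw [isAddTorsion_divisorClassGroup_iff]
  intro δ
  induction δ using Finsupp.induction_linear with
  | zero => exact ⟨1, one_pos, 1, fun P => by simp [P.ord_one]⟩
  | add δ ε hδ hε =>
    obtain ⟨m, hm, x, hx⟩ := hδ
    obtain ⟨n, hn, y, hy⟩ := hε
    refine ⟨m * n, Nat.mul_pos hm hn, x ^ n * y ^ m, fun P => ?_⟩
    rw [P.ord_mul, P.ord_pow, P.ord_pow, hx, hy, Finsupp.add_apply]
    push_cast
    ring
  | single P k =>
    obtain ⟨a, ha⟩ := h P
    have haP : a ∈ P.asIdeal := ha ▸ Ideal.le_radical (Ideal.mem_span_singleton_self a)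
    have ha0 : algebraMap D K a ≠ 0 := by
      rw [Ne, FaithfulSMul.algebraMap_eq_zero_iff]
      rintro rfl
      refine P.ne_bot (ha.trans ?_)
      rw [Ideal.span_singleton_eq_bot.2 rfl, Ideal.radical_bot_of_isReduced]
    let x := Units.mk0 _ ha0
    have hx : 0 < P.ord K x := (P.ord_pos_iff rfl).2 haP
    -- With `e = v_P(a)`, `div a = e P`, so `e` kills the class of `k P`; the power of `x` is an
    -- integer power since `k` may be negative.
    refine ⟨(P.ord K x).toNat, by lia, x ^ k, fun Q => ?_⟩
    have hz : Q.ord K (x ^ k) = k * Q.ord K x := by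
      obtain ⟨n, rfl | rfl⟩ := k.eq_nat_or_neg
      · rw [zpow_natCast, Q.ord_pow]
      · rw [zpow_neg, zpow_natCast, Q.ord_inv, Q.ord_pow, neg_mul]
    rw [hz, Int.toNat_of_nonneg hx.le]
    rcases eq_or_ne P Q with rfl | hPQ
    · rw [Finsupp.single_eq_same, mul_comm]
    · rw [Finsupp.single_eq_of_ne' hPQ, Q.ord_eq_zero x a rfl, mul_zero, mul_zero]
      refine fun haQ => hPQ (HeightOnePrime.eq_of_le ?_)
      rw [ha, Q.isPrime.radical_le_iff]
      simpa using haQ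

/-! ### Proconstructible implies radicals of principal ideals. -/

/-- There is an element of `K` whose only pole is `P`. -/
theorem HeightOnePrime.not_localizationAway_le (P : HeightOnePrime D) :
    ¬ P.localizationAway K ≤ P.localization K := by
  classical
  obtain ⟨a, haP, ha0⟩ := Submodule.exists_mem_ne_zero_of_ne_bot P.ne_bot
  have hfin := IsKrullDomain.finite_setOf_mem K a ha0
  have hex (Q : HeightOnePrime D) : ∃ b : D, b ∉ P.asIdeal ∧ (Q ≠ P → b ∈ Q.asIdeal) := by
    rcases eq_or_ne Q P with rfl | hQ
    · exact ⟨1, Q.isPrime.one_notMem, fun h => (h rfl).elim⟩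
    · obtain ⟨b, hbQ, hbP⟩ := Set.not_subset.1 fun hle => hQ (HeightOnePrime.eq_of_le hle)
      exact ⟨b, hbP, fun _ => hbQ⟩
  choose b hbP hbQ using hex
  -- The factor at `P` itself avoids `P`, so `c` lies in all the other primes containing `a` but not
  -- in `P`. For large `n`, `c ^ n / a` has its only pole at `P`.
  let c := ∏ Q ∈ hfin.toFinset, b Q
  have hcP : c ∉ P.asIdeal := by
    rw [P.isPrime.prod_mem_iff]
    rintro ⟨Q, -, hQ⟩
    exact hbP Q hQ
  have hcQ (Q : HeightOnePrime D) (hQ : Q ≠ P) (haQ : a ∈ Q.asIdeal) : c ∈ Q.asIdeal :=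
    Q.isPrime.prod_mem_iff.2 ⟨Q, hfin.mem_toFinset.2 haQ, hbQ Q hQ⟩
  have haK : algebraMap D K a ≠ 0 := by simpa using ha0
  have hcK : algebraMap D K c ≠ 0 := by
    rw [Ne, FaithfulSMul.algebraMap_eq_zero_iff]
    intro h
    exact hcP (h ▸ zero_mem _)
  let x := Units.mk0 _ haK
  let y := Units.mk0 _ hcK
  -- The sum serves as a common bound for the orders of `a`.
  let n := ∑ Q ∈ hfin.toFinset, (Q.ord K x).toNat
  intro hle
  have hmem : ((y ^ n * x⁻¹ : Kˣ) : K) ∈ P.localizationAway K := by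
    rw [mem_localizationAway_iff]
    intro Q hQ
    have hy : 0 ≤ Q.ord K y := Q.ord_algebraMap_nonneg rfl
    rw [← ord_nonneg_iff, Q.ord_mul, Q.ord_pow, Q.ord_inv]
    by_cases haQ : a ∈ Q.asIdeal
    · have hy : 0 < Q.ord K y := (Q.ord_pos_iff rfl).2 (hcQ Q hQ haQ)
      have hn : (Q.ord K x).toNat ≤ n := Finset.single_le_sum
        (f := fun Q : HeightOnePrime D => (Q.ord K x).toNat) (fun _ _ => Nat.zero_le _)
        (hfin.mem_toFinset.2 haQ)
      have hn' : Q.ord K x ≤ n := by lia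
      nlinarith
    · rw [Q.ord_eq_zero x a rfl haQ]
      simpa using mul_nonneg (by positivity) hy
  have hP := (P.ord_nonneg_iff _).2 (hle hmem)
  have hxP : 0 < P.ord K x := (P.ord_pos_iff rfl).2 haP
  rw [P.ord_mul, P.ord_pow, P.ord_inv, P.ord_eq_zero y c rfl hcP] at hP
  lia

/-- Finitely many conditions only involve finitely many primes: each excluded `g` is outside some
`D_Q` with `Q ≠ P`, and localizing at the complement of the union of these `Q` gives a quotient ring
meeting all the conditions. -/
theorem HeightOnePrime.localizationAway_mem (P : HeightOnePrime D)
    (h : IsProconstructible (quotientOverrings D K)) :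
    P.localizationAway K ∈ quotientOverrings D K := by
  classical
  refine h.mem_of_forall_finset fun F G hF hG => ?_
  have hex (g : G) : ∃ Q : HeightOnePrime D, Q ≠ P ∧ (g : K) ∉ Q.localization K := by
    have := hG g g.2
    rw [mem_localizationAway_iff] at this
    push Not at this
    exact this
  choose Q hQP hgQ using hex
  -- Prime avoidance. Empty `G` is separate: the union of the `Q g` must contain `0`.
  obtain ⟨s, hsP, hs0, hsQ⟩ : ∃ s ∈ P.asIdeal, s ≠ 0 ∧ ∀ g, s ∉ (Q g).asIdeal := by
    rcases isEmpty_or_nonempty G with hG | ⟨⟨g₀⟩⟩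
    · obtain ⟨s, hs, hs0⟩ := Submodule.exists_mem_ne_zero_of_ne_bot P.ne_bot
      exact ⟨s, hs, hs0, fun g => (hG.false g).elim⟩
    by_contra! hn
    have hsub : (P.asIdeal : Set D) ⊆
        ⋃ g ∈ ((Finset.univ : Finset G) : Set G), ((Q g).asIdeal : Set D) := fun s hs => by
      simp only [Set.mem_iUnion]
      rcases eq_or_ne s 0 with rfl | hs0
      · exact ⟨g₀, by simp, zero_mem _⟩
      · obtain ⟨g, hg⟩ := hn s hs hs0
        exact ⟨g, by simp, hg⟩
    obtain ⟨g, -, hg⟩ := (Ideal.subset_union_prime g₀ g₀ fun g _ _ _ => (Q g).isPrime).1 hsub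
    exact hQP g (HeightOnePrime.eq_of_le hg).symm
  -- The factor `D⁰` matters only for empty `G`, where the infimum contains `0`.
  let S : Submonoid D := D⁰ ⊓ ⨅ g, (Q g).asIdeal.primeCompl
  have hS (b : D) : b ∈ S ↔ b ∈ D⁰ ∧ ∀ g, b ∉ (Q g).asIdeal := by
    simp [S, Submonoid.mem_inf, Submonoid.mem_iInf, Ideal.primeCompl]
  refine ⟨_, ⟨S, inf_le_left, rfl⟩, fun f hf => ?_, fun g hg hgS => ?_⟩
  · rcases eq_or_ne f 0 with rfl | hf0
    · exact zero_mem _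
    have hsK : algebraMap D K s ≠ 0 := by simpa using hs0
    let x := Units.mk0 f hf0
    let y := Units.mk0 _ hsK
    -- The only possible pole of `f` is `P`, and a power of `s ∈ P` cancels it.
    obtain ⟨a, ha⟩ := IsKrullDomain.exists_algebraMap_eq (x * y ^ (P.ord K x).natAbs)
      fun R : HeightOnePrime D => by
        rw [R.ord_mul, R.ord_pow]
        rcases eq_or_ne R P with rfl | hR
        · have hy : 0 < R.ord K y := (R.ord_pos_iff rfl).2 hsP
          have h₁ : -R.ord K x ≤ (R.ord K x).natAbs := by lia
          nlinarith
        · have hx : 0 ≤ R.ord K x :=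
            (R.ord_nonneg_iff x).2 (P.mem_localizationAway_iff.1 (hF f hf) R hR)
          have hy : 0 ≤ R.ord K y := R.ord_algebraMap_nonneg rfl
          positivity
    refine mem_ofField_iff.2 ⟨a, s ^ (P.ord K x).natAbs, pow_mem
      ((hS s).2 ⟨mem_nonZeroDivisors_of_ne_zero hs0, hsQ⟩) _, ?_⟩
    rw [← ha, map_pow]
    simp [x, y, hsK]
  · obtain ⟨a, b, hb, hab⟩ := mem_ofField_iff.1 hgS
    exact hgQ ⟨g, hg⟩ ((Q ⟨g, hg⟩).mem_localization_iff.2 ⟨a, b, ((hS b).1 hb).2 _, hab⟩)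

theorem exists_eq_radical_of_isProconstructible
    (h : IsProconstructible (quotientOverrings D K)) (P : HeightOnePrime D) :
    ∃ a : D, P.asIdeal = (Ideal.span {a}).radical := by
  obtain ⟨S, hS, hT⟩ := P.localizationAway_mem h
  -- If `S` avoided `P`, then `S⁻¹D` would be contained in `D_P`.
  obtain ⟨s, hsS, hsP⟩ : ∃ s ∈ S, s ∈ P.asIdeal := by
    by_contra! hn
    refine P.not_localizationAway_le (K := K) fun x hx => ?_
    rw [hT] at hx
    obtain ⟨a, s, hs, hx⟩ := mem_ofField_iff.1 hx
    exact P.mem_localization_iff.2 ⟨a, s, hn s hs, hx⟩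
  have hs0 : s ≠ 0 := nonZeroDivisors.ne_zero (hS hsS)
  refine ⟨s, P.eq_radical_span_of_ord_eq_zero K hs0 hsP fun Q hQ hsQ => ?_⟩
  have hsK : algebraMap D K s ≠ 0 := by simpa using hs0
  let x := Units.mk0 _ hsK
  -- `1 / s` lies in `D_Q` for all `Q ≠ P`, so `s` cannot belong to such a `Q`.
  have hx : ((x⁻¹ : Kˣ) : K) ∈ P.localizationAway K := by
    rw [hT]
    exact mem_ofField_iff.2 ⟨1, s, hsS, by simp [x]⟩
  have h₁ := (Q.ord_nonneg_iff _).2 (P.mem_localizationAway_iff.1 hx Q hQ)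
  have h₂ : 0 < Q.ord K x := (Q.ord_pos_iff rfl).2 hsQ
  rw [Q.ord_inv] at h₁
  lia

end Krull

theorem mainTheorem10 (D K : Type*) [CommRing D] [IsDomain D] [Field K] [Algebra D K]
    [IsFractionRing D K] [IsKrullDomain D K] :
    List.TFAE [
      IsProconstructible (quotientOverrings D K),
      ∀ P : HeightOnePrime D, ∃ a : D, P.asIdeal = (Ideal.span {a}).radical,
      IsAddTorsion (DivisorClassGroup D K)] := by
  tfae_have 1 → 2 := exists_eq_radical_of_isProconstructible
  tfae_have 2 → 3 := isAddTorsion_of_forall_exists_eq_radical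
  tfae_have 3 → 1 := isProconstructible_quotientOverrings_of_isAddTorsion
  tfae_finish
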